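/- **Critical density.** *Network.* For each AP density $\lambda>0$, access points (APs) form a homogeneous Poisson process of density $\lambda$ in $\mathbb R^2$. A link with displacement $x$ has path loss $S\|x\|^4$, where the shadowing $S>0$ is i.i.d. over links with $\mathbb E[S^{-1/2}]<\infty$, and has fast fading i.i.d. $\sim\exp(1)$. A device is served by the AP of least path loss and uses full path-loss inversion power control. Let $L$ denote the path loss from a device to its serving AP. As seen from the AP serving the typical device, the devices transmitting on the same resource block (the interferers) form a marked Poisson process. Each point carries its path loss $Y$ to that AP, its path loss $L_X$ to its own serving AP, and its fading $H_X$. The intensity is that of devices of density $\lambda$ with $Y=S\|x\|^4$ and independent marks $L_X\sim L$, $H_X\sim\exp(1)$, restricted to $L_X<Y$. The network is interference-limited ($\mathtt{SNR}=\infty$), so $$\mathtt{SINR}=\frac{H}{\sum_X L_XH_X/Y_X},$$ where $H\sim\exp(1)$ is independent of the interferers. *Delay.* Devices have density $\lambda_u>0$, and the load of the serving AP is taken to be its average $\bar N=1+1.28\,\lambda_u/\lambda$. The uplink rate is $R=\frac{b}{\bar N}\log_2(1+\mathtt{SINR})$ with bandwidth $b>0$, and the downlink rate is taken to be equal to it.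 With cumulative payload $q>0$ and compute delay $\delta_c\ge 0$, the cloud inference delay is $D=\frac{q}{2R}+\frac{q}{2R}+\delta_c$. The delay budget is $\delta_t>\delta_c$, and the inference rate is $r_{\min}=\frac{q}{b(\delta_t-\delta_c)}$. *MSE.* Let $y$ be the true output, $y_d$ the edge output and $y_c$ the cloud output, with finite mean squared errors $m_d=\mathbb E[(y-y_d)^2]$ and $m_c=\mathbb E[(y-y_c)^2]$, where $m_c\le m_d$. The average MSE at density $\lambda$ is $$\bar m(\lambda)=\mathbb E[\mathbb 1(D\le\delta_t)\,m_c]+\mathbb E[\mathbb 1(D>\delta_t)\,m_d],$$ and $m_{\mathrm{asy}}=\lim_{\lambda\to\infty}\bar m(\lambda)$. *Claim.* Let $C(x)=\sqrt x\arctan\sqrt x$, with inverse $C^{-1}:[0,\infty)\to[0,\infty)$. For every target MSE $m_t$ with $m_{\mathrm{asy}}<m_t<m_d$, the minimum AP density guaranteeing average MSE at most $m_t$ is $$\lambda_c=1.28\,\lambda_u\left\{\frac1{r_{\min}}\log_2\!\left(1+C^{-1}\!\left[\log\frac{m_d-m_c}{m_d-m_t}\right]\right)-1\right\}^{-1}.$$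 That is, $\lambda_c$ is the least element of $\{\lambda>0:\bar m(\lambda)\le m_t\}$, and $\bar m(\lambda)\le m_t$ for all $\lambda\ge\lambda_c$. -/

import Mathlib

open MeasureTheory ProbabilityTheory
open scoped ENNReal NNReal

namespace EdgeCloud

noncomputable section

/-- `N` is a Poisson point process on `E` with intensity measure `Λ`, seen as a random counting
measure: counts of sets of finite intensity are Poisson, and counts of disjoint sets are
independent. -/
structure IsPoissonProcess {Ω E : Type*} [MeasurableSpace Ω] [MeasurableSpace E]
    (P : Measure Ω) (N : Ω → Measure E) (Λ : Measure E) : Prop where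
  measurable : Measurable N
  hasLaw : ∀ A : Set E, MeasurableSet A → Λ A ≠ ∞ →
    HasLaw (fun ω => N ω A)
      ((poissonMeasure (Λ A).toNNReal).map (Nat.cast : ℕ → ℝ≥0∞)) P
  indep : ∀ (n : ℕ) (A : Fin n → Set E), (∀ i, MeasurableSet (A i)) →
    Pairwise (fun i j => Disjoint (A i) (A j)) →
    iIndepFun (fun i ω => N ω (A i)) P

/-- The plane in which access points (APs) and devices live. -/
abbrev Plane : Type := EuclideanSpace ℝ (Fin 2)

/-- Path loss `S ‖x‖⁴` over a link with displacement `x` and shadowing `s`. -/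
def pathLoss (x : Plane) (s : ℝ) : ℝ≥0∞ := ENNReal.ofReal (s * ‖x‖ ^ 4)

/-- Intensity of the APs of density `lam`, each marked with the shadowing (law `σ`) of its link to
a device at the origin. -/
def apIntensity (lam : ℝ) (σ : Measure ℝ) : Measure (Plane × ℝ) :=
  (ENNReal.ofReal lam • (volume : Measure Plane)).prod σ

/-- Path loss from a device at the origin to its serving AP: the least path loss over the points
of `N` (the essential infimum over a counting measure is the infimum over its points). -/
def servingPathLoss (N : Measure (Plane × ℝ)) : ℝ≥0∞ :=
  essInf (fun p : Plane × ℝ => pathLoss p.1 p.2) N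

/-- An interfering device, seen from the AP that serves the typical device. -/
abbrev Interferer : Type := (Plane × ℝ) × ℝ≥0∞ × ℝ

/-- Path loss from the interferer to the AP of the typical device. -/
def Interferer.crossLoss (z : Interferer) : ℝ≥0∞ := pathLoss z.1.1 z.1.2

/-- Path loss from the interferer to its own serving AP. -/
def Interferer.ownLoss (z : Interferer) : ℝ≥0∞ := z.2.1

/-- Fast fading from the interferer to the AP of the typical device. -/
def Interferer.fading (z : Interferer) : ℝ := z.2.2

/-- Intensity of the devices transmitting on the resource block of the typical device: one device
per cell, hence density `lam`; shadowing of law `σ`, path loss to its own serving AP of law `κ`,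
unit-mean exponential fading; and, because each device is associated with the AP of minimum path
loss, only devices whose own path loss is below the path loss to the AP of the typical device. -/
def interfererIntensity (lam : ℝ) (σ : Measure ℝ) (κ : Measure ℝ≥0∞) : Measure Interferer :=
  ((apIntensity lam σ).prod (κ.prod (expMeasure 1))).restrict
    {z : Interferer | z.ownLoss < z.crossLoss}

/-- A cellular network of AP density `lam` and shadowing law `σ`, as seen by the typical device:
`Φ` is the shadowing-marked process of APs around a device, `Ψ` the process of interferers around
the AP of the typical device, and `H` the fast fading of the typical link. -/
structure IsNetwork {Ω : Type*} [MeasurableSpace Ω] (P : Measure Ω) (σ : Measure ℝ) (lam : ℝ)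
    (Φ : Ω → Measure (Plane × ℝ)) (Ψ : Ω → Measure Interferer) (H : Ω → ℝ) : Prop where
  aps : IsPoissonProcess P Φ (apIntensity lam σ)
  interferers : IsPoissonProcess P Ψ
    (interfererIntensity lam σ (P.map (fun ω => servingPathLoss (Φ ω))))
  measurable_fading : Measurable H
  fading : HasLaw H (expMeasure 1) P
  indep : IndepFun H Ψ P

/-- Uplink interference under full path-loss inversion: the sum over the interferers of
(own path loss) × (fading) / (path loss to the AP of the typical device). -/
def interference (N : Measure Interferer) : ℝ≥0∞ :=
  ∫⁻ z, z.ownLoss * ENNReal.ofReal z.fading / z.crossLoss ∂N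

/-- Uplink SINR of the typical device, for fading `h` of its link. -/
def uplinkSINR (snr : ℝ≥0∞) (h : ℝ) (N : Measure Interferer) : ℝ≥0∞ :=
  ENNReal.ofReal h / (snr⁻¹ + interference N)

/-- Spectral efficiency `log₂ (1 + x)`. -/
def spectralEfficiency (x : ℝ≥0∞) : ℝ≥0∞ :=
  if x = ∞ then ∞ else ENNReal.ofReal (Real.logb 2 (1 + x.toReal))

/-- Average load of the AP of the typical device, `1 + 1.28 / (lam / lamu)`. -/
def meanLoad (lam lamu : ℝ) : ℝ := 1 + 1.28 / (lam / lamu)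

/-- Rate with bandwidth `b` shared equally by `load` devices. -/
def rate (b load : ℝ) (sinr : ℝ≥0∞) : ℝ≥0∞ :=
  ENNReal.ofReal (b / load) * spectralEfficiency sinr

/-- Cloud inference delay, for uplink rate `Ru`, downlink rate `Rd`, cumulative payload `q` (half
in each direction) and compute delay `δc`. -/
def cloudDelay (q δc : ℝ) (Ru Rd : ℝ≥0∞) : ℝ≥0∞ :=
  ENNReal.ofReal q / (2 * Ru) + ENNReal.ofReal q / (2 * Rd) + ENNReal.ofReal δc

/-- Cloud inference delay of the typical device at AP density `lam` and device density `lamu`, with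
load equal to its average, and downlink rate equal to the uplink rate. -/
def typicalDelay (q b δc lamu : ℝ) (snr : ℝ≥0∞) (lam h : ℝ) (N : Measure Interferer) : ℝ≥0∞ :=
  let R := rate b (meanLoad lam lamu) (uplinkSINR snr h N)
  cloudDelay q δc R R

/-- Mean squared error of the prediction `y'` of `y`. -/
def mse {A : Type*} [MeasurableSpace A] (ν : Measure A) (y y' : A → ℝ) : ℝ :=
  ∫ a, (y a - y' a) ^ 2 ∂ν

/-- Average MSE of the output: the cloud output (MSE `mc`) is used when the delay `D` meets the
budget `δt`, and the edge output (MSE `md`) otherwise. -/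
def averageMSE {Ω : Type*} [MeasurableSpace Ω] (P : Measure Ω) (D : Ω → ℝ≥0∞)
    (δt mc md : ℝ) : ℝ :=
  (∫ ω, {ω | D ω ≤ ENNReal.ofReal δt}.indicator (fun _ => mc) ω ∂P) +
    ∫ ω, {ω | ENNReal.ofReal δt < D ω}.indicator (fun _ => md) ω ∂P

/-- Average MSE of the limit of high AP density, for the average MSE `m` as a function of the AP
density. -/
def asymptoticMSE (m : ℝ → ℝ) : ℝ := Filter.limUnder Filter.atTop m

/-- The inference rate: the required rate, normalized by the bandwidth. -/
def inferenceRate (q b δt δc : ℝ) : ℝ := q / (b * (δt - δc))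

/-- `C(x) = √x arctan √x`. -/
def C (x : ℝ) : ℝ := √x * Real.arctan (√x)

/-- The inverse of `C` as a function from `[0, ∞)` to `[0, ∞)`. -/
def Cinv : ℝ → ℝ := Function.invFunOn C (Set.Ici 0)

/-- The critical density. -/
def criticalDensity (lamu rmin mc md mt : ℝ) : ℝ :=
  1.28 * lamu *
    (1 / rmin * Real.logb 2 (1 + Cinv (Real.log ((md - mc) / (md - mt)))) - 1)⁻¹

end

end EdgeCloud

/-!
The fading `H` of the typical link is exponential and independent of the interference `I`, so
`P(SINR ≥ γ) = P(H ≥ γ I) = E[exp (-γ I)]` is the Laplace transform of a sum over a Poisson process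
(`IsPoissonProcess.lintegral_expNeg`). By that formula its exponent is the integral of
`1 - exp (-γ L H / Y)` against the intensity of the interferers. Three facts make this integral
equal to `C γ`, whatever the AP density and the shadowing:

* in the plane and for path loss exponent `4`, the square roots `r = √Y` of the path losses to an AP
  have intensity `a dr` with `a = π λ E[S^{-1/2}]` (`lintegral_pathLoss_apIntensity`);
* averaging over the exponential fading and then over `r > √L` turns the integral into
  `a ∫_{√L}^∞ γ L / (r² + γ L) dr = a √L C(γ)` (`lintegral_Ioi_div_sq_add`);
* `√L`, the least point of a Poisson process of intensity `a dr`, is exponential of mean `1 / a`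
  (`lintegral_servingPathLoss_rpow`), so `a` cancels.

The delay meets its budget exactly when the SINR is at least `γ(λ) = 2^(rmin (1 + 1.28 λᵤ / λ)) - 1`
(`typicalDelay_le_iff`), whence the average MSE is `md - (md - mc) exp (-C (γ(λ)))`
(`IsNetwork.averageMSE_eq`). Inverting the increasing function `C` and the decreasing function
`γ` solves `average MSE ≤ mt` for `λ`. The assumption that `mt` exceeds the asymptotic MSE says that
`C⁻¹[log ((md - mc) / (md - mt))]` exceeds the limit `2^rmin - 1` of `γ`, which is the positivity
of the critical density.
-/

namespace EdgeCloud

open Set Filter Topology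

/-! ### The exponential `e⁻ˣ` on `[0, ∞]` -/

/-- The function `x ↦ e⁻ˣ` on `[0, ∞]`, with `e^(-∞) = 0`. -/
noncomputable def expNeg (x : ℝ≥0∞) : ℝ≥0∞ := EReal.exp (-(x : EReal))

lemma expNeg_ofReal {x : ℝ} (hx : 0 ≤ x) :
    expNeg (ENNReal.ofReal x) = ENNReal.ofReal (Real.exp (-x)) := by
  rw [expNeg, EReal.coe_ennreal_ofReal, max_eq_left hx, ← EReal.coe_neg, EReal.exp_coe]

@[simp] lemma expNeg_zero : expNeg 0 = 1 := by simp [expNeg]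

@[simp] lemma expNeg_top : expNeg ∞ = 0 := by simp [expNeg]

lemma expNeg_add (x y : ℝ≥0∞) : expNeg (x + y) = expNeg x * expNeg y := by
  simp only [expNeg]
  rw [EReal.coe_ennreal_add, EReal.neg_add (by simp) (by simp), sub_eq_add_neg, EReal.exp_add]

lemma expNeg_sum {ι : Type*} (s : Finset ι) (f : ι → ℝ≥0∞) :
    expNeg (∑ i ∈ s, f i) = ∏ i ∈ s, expNeg (f i) := by
  classical
  induction s using Finset.induction_on with
  | empty => simp
  | insert i s hi ih => rw [Finset.sum_insert hi, Finset.prod_insert hi, expNeg_add, ih]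

lemma expNeg_antitone : Antitone expNeg := fun x y h => by
  simpa [expNeg] using h

lemma expNeg_le_one (x : ℝ≥0∞) : expNeg x ≤ 1 := by
  simpa using expNeg_antitone (zero_le : 0 ≤ x)

lemma continuous_expNeg : Continuous expNeg :=
  EReal.expHomeomorph.continuous.comp (continuous_neg.comp continuous_coe_ennreal_ereal)

lemma measurable_expNeg : Measurable expNeg := continuous_expNeg.measurable

/-! ### The exponential distribution -/

/-- The tail of the unit-mean exponential distribution. -/
lemma expMeasure_le_ofReal (x : ℝ≥0∞) : expMeasure 1 {h | x ≤ ENNReal.ofReal h} = expNeg x := by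
  have := isProbabilityMeasure_expMeasure one_pos
  by_cases hx : x = ∞
  · simp [hx]
  by_cases hx0 : x = 0
  · simp [hx0]
  lift x to ℝ≥0 using hx
  have hx' : 0 < x := by simpa [pos_iff_ne_zero] using hx0
  have hset : {h : ℝ | (x : ℝ≥0∞) ≤ ENNReal.ofReal h} = Ici (x : ℝ) := by
    ext h
    simp only [mem_ofPred_eq, mem_Ici]
    rw [← ENNReal.ofReal_coe_nnreal]
    by_cases hh : 0 ≤ h
    · exact ENNReal.ofReal_le_ofReal_iff hh
    · push Not at hh
      simp [ENNReal.ofReal_of_nonpos hh.le, hx'.ne', hh.trans (NNReal.coe_pos.2 hx')]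
  have hna : NullSingletonClass (expMeasure 1) :=
    inferInstanceAs (NullSingletonClass (volume.withDensity (gammaPDF 1 1)))
  rw [hset, ← measure_congr Ioi_ae_eq_Ici, ← compl_Iic, prob_compl_eq_one_sub measurableSet_Iic,
    ← ENNReal.ofReal_coe_nnreal (p := x), expNeg_ofReal x.coe_nonneg, ← ofReal_cdf,
    cdf_expMeasure_eq one_pos,
    if_pos x.coe_nonneg, ← ENNReal.ofReal_one, ← ENNReal.ofReal_sub _ (by simp)]
  simp

lemma lintegral_expMeasure (G : ℝ → ℝ≥0∞) (hG : Measurable G) :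
    ∫⁻ h, G h ∂expMeasure 1 = ∫⁻ h in Ioi 0, ENNReal.ofReal (Real.exp (-h)) * G h := by
  have hpdf : Measurable (exponentialPDF 1) := (measurable_exponentialPDFReal 1).ennreal_ofReal
  have : expMeasure 1 = volume.withDensity (exponentialPDF 1) := rfl
  rw [this, lintegral_withDensity_eq_lintegral_mul _ hpdf hG,
    ← lintegral_add_compl _ (measurableSet_Ici (a := (0 : ℝ))), compl_Ici,
    setLIntegral_congr_fun measurableSet_Iio (g := fun _ => 0)
      (fun h hh => by simp [exponentialPDF_of_neg hh]),
    lintegral_zero, add_zero, setLIntegral_congr Ioi_ae_eq_Ici.symm]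
  refine setLIntegral_congr_fun measurableSet_Ioi fun h hh => ?_
  simp [exponentialPDF_of_nonneg (le_of_lt hh)]

lemma lintegral_exp_neg_mul {a : ℝ} (ha : 0 < a) :
    ∫⁻ x in Ioi 0, ENNReal.ofReal (Real.exp (-(a * x))) = ENNReal.ofReal a⁻¹ := by
  simp only [neg_mul_eq_neg_mul]
  rw [← ofReal_integral_eq_lintegral_ofReal (exp_neg_integrableOn_Ioi 0 ha)
    (ae_of_all _ fun x => (Real.exp_pos _).le), integral_exp_mul_Ioi (neg_lt_zero.2 ha)]
  congr 1
  simp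

/-- The Laplace transform of the unit-mean exponential distribution. -/
lemma lintegral_one_sub_expNeg_expMeasure {c : ℝ} (hc : 0 ≤ c) :
    ∫⁻ h, (1 - expNeg (ENNReal.ofReal c * ENNReal.ofReal h)) ∂expMeasure 1 =
      ENNReal.ofReal (c / (1 + c)) := by
  have := isProbabilityMeasure_expMeasure one_pos
  have hm : Measurable fun h => expNeg (ENNReal.ofReal c * ENNReal.ofReal h) :=
    measurable_expNeg.comp (by fun_prop)
  have h1 : ∫⁻ h, expNeg (ENNReal.ofReal c * ENNReal.ofReal h) ∂expMeasure 1 =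
      ENNReal.ofReal (1 + c)⁻¹ := by
    rw [lintegral_expMeasure _ hm, ← lintegral_exp_neg_mul (by positivity)]
    refine setLIntegral_congr_fun measurableSet_Ioi fun h hh => ?_
    have hh : 0 < h := hh
    rw [← ENNReal.ofReal_mul hc, expNeg_ofReal (by positivity),
      ← ENNReal.ofReal_mul (Real.exp_pos _).le, ← Real.exp_add]
    ring_nf
  rw [lintegral_sub hm (by rw [h1]; simp) (ae_of_all _ fun _ => expNeg_le_one _), h1]
  simp only [lintegral_const, measure_univ, mul_one]
  rw [← ENNReal.ofReal_one, ← ENNReal.ofReal_sub _ (by positivity)]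
  congr 1
  field_simp
  ring

/-! ### The Laplace functional of a Poisson process -/

section Poisson

variable {Ω E : Type*} [MeasurableSpace Ω] [MeasurableSpace E] {P : Measure Ω}
  {N : Ω → Measure E} {Λ : Measure E}

/-- The Laplace transform of a Poisson distribution. -/
lemma lintegral_expNeg_mul_poissonMeasure (r c : ℝ≥0) :
    ∫⁻ n : ℕ, expNeg (c * n) ∂poissonMeasure r = expNeg (r * (1 - expNeg c)) := by
  have hs := (NormedSpace.expSeries_div_hasSum_exp ((r : ℝ) * Real.exp (-c))).mul_left
    (Real.exp (-r))
  rw [← Real.exp_eq_exp_ℝ] at hs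
  have hr : (r : ℝ≥0∞) * (1 - expNeg c) = ENNReal.ofReal (r * (1 - Real.exp (-c))) := by
    rw [← ENNReal.ofReal_coe_nnreal (p := c), expNeg_ofReal c.coe_nonneg, ← ENNReal.ofReal_one,
      ← ENNReal.ofReal_sub _ (Real.exp_pos _).le, ENNReal.ofReal_mul r.coe_nonneg,
      ENNReal.ofReal_coe_nnreal]
  rw [hr, expNeg_ofReal (mul_nonneg r.coe_nonneg (by simp)), poissonMeasure, lintegral_sum_measure]
  have : Real.exp (-(r * (1 - Real.exp (-c)))) = Real.exp (-r) * Real.exp (r * Real.exp (-c)) := by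
    rw [← Real.exp_add]; ring_nf
  rw [this, ← hs.tsum_eq, ENNReal.ofReal_tsum_of_nonneg (fun n => by positivity) hs.summable]
  congr 1; ext n
  have : (c : ℝ≥0∞) * n = ENNReal.ofReal (n * c) := by
    rw [ENNReal.ofReal_mul (by positivity)]; simp [mul_comm]
  rw [lintegral_smul_measure, lintegral_dirac, this, expNeg_ofReal (by positivity), smul_eq_mul,
    ← ENNReal.ofReal_mul (by positivity), mul_pow, ← Real.exp_nat_mul]
  congr 1
  rw [mul_neg]; ring

namespace IsPoissonProcess

lemma lintegral_expNeg_mul_measure (h : IsPoissonProcess P N Λ) {A : Set E}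
    (hA : MeasurableSet A) (hΛ : Λ A ≠ ∞) {c : ℝ≥0∞} (hc : c ≠ ∞) :
    ∫⁻ ω, expNeg (c * N ω A) ∂P = expNeg (Λ A * (1 - expNeg c)) := by
  lift c to ℝ≥0 using hc
  have hm : Measurable fun x : ℝ≥0∞ => expNeg (c * x) :=
    measurable_expNeg.comp (by fun_prop)
  rw [← lintegral_map' (f := fun x => expNeg (c * x)) hm.aemeasurable
      (h.hasLaw A hA hΛ).aemeasurable,
    (h.hasLaw A hA hΛ).map_eq, lintegral_map hm (by fun_prop), lintegral_expNeg_mul_poissonMeasure,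
    ENNReal.coe_toNNReal hΛ]

/-- The void probabilities of a Poisson process. -/
lemma measure_eq_zero (h : IsPoissonProcess P N Λ) {A : Set E}
    (hA : MeasurableSet A) (hΛ : Λ A ≠ ∞) : P {ω | N ω A = 0} = expNeg (Λ A) := by
  rw [(h.hasLaw A hA hΛ).measure_eq (p := fun x => x = 0) (measurableSet_singleton 0),
    Measure.map_apply (by fun_prop) (s := {x | x = 0}) (measurableSet_singleton 0)]
  have : (Nat.cast : ℕ → ℝ≥0∞) ⁻¹' {x | x = 0} = {0} := by ext; simp
  rw [this, poissonMeasure_singleton]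
  lift Λ A to ℝ≥0 using hΛ with r
  rw [← ENNReal.ofReal_coe_nnreal, expNeg_ofReal r.coe_nonneg]
  simp

lemma lintegral_expNeg_simpleFunc (h : IsPoissonProcess P N Λ) (g : SimpleFunc E ℝ≥0∞)
    (hg : ∀ x, g x ≠ ∞) (hΛ : ∀ c, c ≠ 0 → Λ (g ⁻¹' {c}) ≠ ∞) [IsProbabilityMeasure P] :
    ∫⁻ ω, expNeg (∫⁻ x, g x ∂N ω) ∂P = expNeg (∫⁻ x, (1 - expNeg (g x)) ∂Λ) := by
  have hind : iIndepFun (fun (c : g.range) ω => N ω (g ⁻¹' {(c : ℝ≥0∞)})) P := by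
    have := h.indep _ (fun i => g ⁻¹' {((g.range.equivFin.symm i : g.range) : ℝ≥0∞)})
      (fun i => g.measurableSet_preimage _) fun i j hij =>
        Disjoint.preimage _ (by
          simpa [Subtype.ext_iff] using
            fun e => hij (g.range.equivFin.symm.injective (Subtype.ext e)))
    simpa using this.precomp g.range.equivFin.injective
  have hN : ∀ A, MeasurableSet A → Measurable fun ω => N ω A := fun A hA =>
    (Measure.measurable_coe hA).comp h.measurable
  have key : ∀ c : g.range, ∫⁻ ω, expNeg (c * N ω (g ⁻¹' {(c : ℝ≥0∞)})) ∂P =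
      expNeg (Λ (g ⁻¹' {(c : ℝ≥0∞)}) * (1 - expNeg c)) := by
    rintro ⟨c, hc⟩
    -- The level set of the value `0` may have infinite intensity, but does not contribute.
    by_cases h0 : c = 0
    · simp [h0]
    · obtain ⟨x, rfl⟩ := SimpleFunc.mem_range.1 hc
      exact h.lintegral_expNeg_mul_measure (g.measurableSet_preimage _) (hΛ _ h0) (hg x)
  have hmap : ∫⁻ x, (1 - expNeg (g x)) ∂Λ =
      ∑ c : g.range, Λ (g ⁻¹' {(c : ℝ≥0∞)}) * (1 - expNeg c) := by
    rw [Finset.sum_coe_sort g.range fun c => Λ (g ⁻¹' {c}) * (1 - expNeg c)]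
    have := SimpleFunc.lintegral_eq_lintegral (g.map fun c => 1 - expNeg c) Λ
    rw [SimpleFunc.map_lintegral] at this
    simp only [SimpleFunc.coe_map, Function.comp_apply] at this
    rw [this]
    exact Finset.sum_congr rfl fun c _ => mul_comm _ _
  have hgN : ∀ ω, expNeg (∫⁻ x, g x ∂N ω) =
      ∏ c : g.range, expNeg (c * N ω (g ⁻¹' {(c : ℝ≥0∞)})) := fun ω => by
    rw [SimpleFunc.lintegral_eq_lintegral, SimpleFunc.lintegral, expNeg_sum,
      ← Finset.prod_coe_sort]
  simp_rw [hgN, hmap]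
  rw [expNeg_sum, lintegral_prod_eq_prod_lintegral_of_indepFun
    (X := fun (c : g.range) ω => expNeg (c * N ω (g ⁻¹' {(c : ℝ≥0∞)})))]
  · exact Finset.prod_congr rfl fun c _ => key c
  · exact hind.comp (fun c x => expNeg (c * x)) fun c => measurable_expNeg.comp (by fun_prop)
  · exact fun c => measurable_expNeg.comp ((hN _ (g.measurableSet_preimage _)).const_mul _)

/-- The Laplace functional of a Poisson process of σ-finite intensity. It passes from simple
functions, where it is independence of the counts together with the Laplace transform of the
Poisson distribution, to nonnegative measurable functions by monotone convergence. -/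
theorem lintegral_expNeg (h : IsPoissonProcess P N Λ) [IsProbabilityMeasure P] [SigmaFinite Λ]
    {f : E → ℝ≥0∞} (hf : Measurable f) :
    ∫⁻ ω, expNeg (∫⁻ x, f x ∂N ω) ∂P = expNeg (∫⁻ x, (1 - expNeg (f x)) ∂Λ) := by
  -- The cutoff to the spanning sets gives the nonzero values level sets of finite intensity.
  let g : ℕ → SimpleFunc E ℝ≥0∞ := fun n =>
    (SimpleFunc.eapprox f n).restrict (spanningSets Λ n)
  have hgx : ∀ n x, g n x = (spanningSets Λ n).indicator (SimpleFunc.eapprox f n) x := fun n x =>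
    SimpleFunc.restrict_apply _ (measurableSet_spanningSets Λ n) x
  have hmono : ∀ x, Monotone fun n => g n x := fun x m n hmn => by
    simp only [hgx]
    exact (indicator_le_indicator_of_subset (monotone_spanningSets Λ hmn)
      (fun _ => zero_le) x).trans
      (indicator_le_indicator (SimpleFunc.monotone_eapprox f hmn x))
  have hlim : ∀ x, Tendsto (fun n => g n x) atTop (𝓝 (f x)) := fun x => by
    refine (SimpleFunc.tendsto_eapprox hf x).congr' ?_
    obtain ⟨n, hn⟩ := mem_iUnion.1 ((iUnion_spanningSets Λ).symm ▸ mem_univ x)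
    filter_upwards [eventually_ge_atTop n] with k hk
    rw [hgx, indicator_of_mem (monotone_spanningSets Λ hk hn)]
  have hN : ∀ ω, Tendsto (fun n => ∫⁻ x, g n x ∂N ω) atTop (𝓝 (∫⁻ x, f x ∂N ω)) := fun ω =>
    lintegral_tendsto_of_tendsto_of_monotone (fun n => (g n).measurable.aemeasurable)
      (ae_of_all _ hmono) (ae_of_all _ hlim)
  have hL : Tendsto (fun n => ∫⁻ x, (1 - expNeg (g n x)) ∂Λ) atTop
      (𝓝 (∫⁻ x, (1 - expNeg (f x)) ∂Λ)) :=
    lintegral_tendsto_of_tendsto_of_monotone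
      (fun n => (measurable_const.sub (measurable_expNeg.comp (g n).measurable)).aemeasurable)
      (ae_of_all _ fun x m n hmn => tsub_le_tsub_left (expNeg_antitone (hmono x hmn)) _)
      (ae_of_all _ fun x => ENNReal.Tendsto.sub tendsto_const_nhds
        ((continuous_expNeg.tendsto _).comp (hlim x)) (Or.inl ENNReal.one_ne_top))
  have hP : Tendsto (fun n => ∫⁻ ω, expNeg (∫⁻ x, g n x ∂N ω) ∂P) atTop
      (𝓝 (∫⁻ ω, expNeg (∫⁻ x, f x ∂N ω) ∂P)) :=
    tendsto_lintegral_of_dominated_convergence (fun _ => 1)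
      (fun n => measurable_expNeg.comp
        ((Measure.measurable_lintegral (g n).measurable).comp h.measurable))
      (fun n => ae_of_all _ fun ω => expNeg_le_one _) (by simp)
      (ae_of_all _ fun ω => (continuous_expNeg.tendsto _).comp (hN ω))
  refine tendsto_nhds_unique hP (((continuous_expNeg.tendsto _).comp hL).congr fun n => ?_)
  refine (h.lintegral_expNeg_simpleFunc (g n) (fun x => ?_) fun c hc => ?_).symm
  · rw [hgx]
    exact ((indicator_le_self' (fun _ _ => zero_le) x).trans_lt
      (SimpleFunc.eapprox_lt_top f n x)).ne
  · refine ((measure_mono fun x hx => ?_).trans_lt (measure_spanningSets_lt_top Λ n)).ne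
    by_contra hxs
    rw [mem_preimage, hgx, indicator_of_notMem hxs] at hx
    exact hc hx.symm

end IsPoissonProcess

end Poisson

/-! ### Path losses seen from the origin -/

@[fun_prop]
lemma measurable_pathLoss : Measurable fun p : Plane × ℝ => pathLoss p.1 p.2 := by
  unfold pathLoss
  fun_prop

/-- In the plane, the image of Lebesgue measure under `x ↦ c ‖x‖²` is a multiple of Lebesgue
measure on the half-line. -/
lemma map_mul_norm_sq_volume {c : ℝ} (hc : 0 < c) :
    (volume : Measure Plane).map (fun x => c * ‖x‖ ^ 2) =
      ENNReal.ofReal (Real.pi / c) • volume.restrict (Ioi 0) := by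
  have hm : Measurable fun x : Plane => c * ‖x‖ ^ 2 := by fun_prop
  have hIio : ∀ t, (volume : Measure Plane).map (fun x => c * ‖x‖ ^ 2) (Iio t) =
      ENNReal.ofReal (Real.pi / c) * ENNReal.ofReal t := fun t => by
    have hpre : (fun x : Plane => c * ‖x‖ ^ 2) ⁻¹' Iio t = Metric.ball 0 √(t / c) := by
      ext x
      rw [mem_ball_zero_iff, Real.lt_sqrt (norm_nonneg x), lt_div_iff₀ hc, mul_comm]
      rfl
    rw [Measure.map_apply hm measurableSet_Iio, hpre, EuclideanSpace.volume_ball_fin_two,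
      ← ENNReal.ofReal_pow (Real.sqrt_nonneg _)]
    rcases le_or_gt t 0 with ht | ht
    · rw [Real.sqrt_eq_zero_of_nonpos (div_nonpos_of_nonpos_of_nonneg ht hc.le),
        ENNReal.ofReal_of_nonpos ht]
      simp
    · rw [Real.sq_sqrt (by positivity), ← ENNReal.ofReal_mul (by positivity),
        ← ENNReal.ofReal_mul (by positivity)]
      congr 1
      ring
  refine Measure.ext_of_generateFrom_of_iUnion (range Iio) (fun n : ℕ => Iio (n : ℝ))
    (borel_eq_generateFrom_Iio ℝ ▸ BorelSpace.measurable_eq) isPiSystem_Iio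
    (iUnion_eq_univ_iff.2 fun x => exists_nat_gt x) (fun n => mem_range_self _) (fun n => ?_) ?_
  · rw [hIio]
    exact ENNReal.mul_ne_top ENNReal.ofReal_ne_top ENNReal.ofReal_ne_top
  · rintro _ ⟨t, rfl⟩
    rw [hIio, Measure.smul_apply, Measure.restrict_apply measurableSet_Iio, Iio_inter_Ioi,
      Real.volume_Ioo, sub_zero, smul_eq_mul]

/-- The rate `a = π λ E[S^{-1/2}]` at which the square roots of the path losses to the points of a
process of density `lam` are spread over `(0, ∞)`. -/
noncomputable def sqrtLossRate (lam : ℝ) (σ : Measure ℝ) : ℝ :=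
  Real.pi * lam * (∫⁻ s, ENNReal.ofReal (s ^ (-(1 / 2) : ℝ)) ∂σ).toReal

section PathLoss

variable {lam : ℝ} {σ : Measure ℝ}

lemma sqrtLossRate_pos [IsProbabilityMeasure σ] (hlam : 0 < lam) (hσ : ∀ᵐ s ∂σ, 0 < s)
    (hσ' : ∫⁻ s, ENNReal.ofReal (s ^ (-(1 / 2) : ℝ)) ∂σ ≠ ∞) : 0 < sqrtLossRate lam σ := by
  refine mul_pos (by positivity) (ENNReal.toReal_pos (fun h0 => ?_) hσ')
  rw [lintegral_eq_zero_iff (by fun_prop)] at h0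
  obtain ⟨s, hs, h⟩ := (hσ.and h0).exists
  have : 0 < s ^ (-(1 / 2) : ℝ) := Real.rpow_pos_of_pos hs _
  simp only [Pi.zero_apply, ENNReal.ofReal_eq_zero] at h
  linarith

/-- The square roots of the path losses to the points of a process of density `lam` have intensity
`a dr` on `(0, ∞)`: the shadowing only enters through `E[S^{-1/2}]`. -/
lemma lintegral_pathLoss_apIntensity [IsProbabilityMeasure σ] (hlam : 0 < lam)
    (hσ : ∀ᵐ s ∂σ, 0 < s) (hσ' : ∫⁻ s, ENNReal.ofReal (s ^ (-(1 / 2) : ℝ)) ∂σ ≠ ∞)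
    {F : ℝ≥0∞ → ℝ≥0∞} (hF : Measurable F) :
    ∫⁻ p, F (pathLoss p.1 p.2) ∂apIntensity lam σ =
      ENNReal.ofReal (sqrtLossRate lam σ) * ∫⁻ r in Ioi (0 : ℝ), F (ENNReal.ofReal (r ^ 2)) := by
  have hG : Measurable fun r : ℝ => F (ENNReal.ofReal (r ^ 2)) := hF.comp (by fun_prop)
  have hfib : ∀ᵐ s ∂σ, ∫⁻ x, F (pathLoss x s) ∂(ENNReal.ofReal lam • (volume : Measure Plane)) =
      ENNReal.ofReal (Real.pi * lam) * (∫⁻ r in Ioi (0 : ℝ), F (ENNReal.ofReal (r ^ 2))) *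
        ENNReal.ofReal (s ^ (-(1 / 2) : ℝ)) := by
    filter_upwards [hσ] with s hs
    have hsq : 0 < √s := Real.sqrt_pos.2 hs
    have : ∀ x : Plane, F (pathLoss x s) = F (ENNReal.ofReal ((√s * ‖x‖ ^ 2) ^ 2)) := fun x => by
      rw [pathLoss, mul_pow, Real.sq_sqrt hs.le, ← pow_mul]
    simp_rw [lintegral_smul_measure, this]
    rw [← lintegral_map (f := fun r : ℝ => F (ENNReal.ofReal (r ^ 2)))
      (g := fun x : Plane => √s * ‖x‖ ^ 2) hG (by fun_prop), map_mul_norm_sq_volume hsq,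
      lintegral_smul_measure, Real.rpow_neg hs.le, ← Real.sqrt_eq_rpow, div_eq_mul_inv,
      ENNReal.ofReal_mul (by positivity), ENNReal.ofReal_mul (by positivity)]
    simp only [smul_eq_mul]
    ring
  have hFp : Measurable fun p : Plane × ℝ => F (pathLoss p.1 p.2) := hF.comp measurable_pathLoss
  rw [apIntensity, lintegral_prod_symm _ hFp.aemeasurable,
    lintegral_congr_ae hfib, lintegral_const_mul _ (by fun_prop), sqrtLossRate,
    ENNReal.ofReal_mul (p := Real.pi * lam) (by positivity), ENNReal.ofReal_toReal hσ']
  ring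

lemma apIntensity_pathLoss_lt [IsProbabilityMeasure σ] (hlam : 0 < lam)
    (hσ : ∀ᵐ s ∂σ, 0 < s) (hσ' : ∫⁻ s, ENNReal.ofReal (s ^ (-(1 / 2) : ℝ)) ∂σ ≠ ∞)
    {u : ℝ} (hu : 0 ≤ u) :
    apIntensity lam σ {p | pathLoss p.1 p.2 < ENNReal.ofReal (u ^ 2)} =
      ENNReal.ofReal (sqrtLossRate lam σ * u) := by
  have hS : MeasurableSet {p : Plane × ℝ | pathLoss p.1 p.2 < ENNReal.ofReal (u ^ 2)} :=
    measurableSet_lt measurable_pathLoss measurable_const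
  have := lintegral_pathLoss_apIntensity hlam hσ hσ'
    (F := (Iio (ENNReal.ofReal (u ^ 2))).indicator 1) (measurable_one.indicator measurableSet_Iio)
  rw [← lintegral_indicator_one hS]
  refine Eq.trans ?_ (this.trans ?_)
  · rfl
  · rw [ENNReal.ofReal_mul (sqrtLossRate_pos hlam hσ hσ').le]
    congr 1
    have hr : ∀ r ∈ Ioi (0 : ℝ), (Iio (ENNReal.ofReal (u ^ 2))).indicator 1 (ENNReal.ofReal (r ^ 2))
        = (Iio u).indicator (1 : ℝ → ℝ≥0∞) r := fun r hr => by
      have hr : 0 < r := hr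
      have : ENNReal.ofReal (r ^ 2) < ENNReal.ofReal (u ^ 2) ↔ r < u := by
        rw [ENNReal.ofReal_lt_ofReal_iff_of_nonneg (by positivity),
          pow_lt_pow_iff_left₀ hr.le hu two_ne_zero]
      simp only [indicator_apply, mem_Iio, this]
      rfl
    rw [setLIntegral_congr_fun measurableSet_Ioi hr, lintegral_indicator_one measurableSet_Iio,
      Measure.restrict_apply measurableSet_Iio, Iio_inter_Ioi, Real.volume_Ioo, sub_zero]

end PathLoss

/-! ### The path loss to the serving access point -/

lemma le_servingPathLoss_iff (N : Measure (Plane × ℝ)) (t : ℝ≥0∞) :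
    t ≤ servingPathLoss N ↔ N {p | pathLoss p.1 p.2 < t} = 0 := by
  have hae : (∀ᵐ p ∂N, t ≤ pathLoss p.1 p.2) ↔ N {p | pathLoss p.1 p.2 < t} = 0 := by
    simp [ae_iff]
  rw [← hae]
  refine ⟨fun h => ?_, fun h => le_essInf_of_ae_le t h⟩
  filter_upwards [ae_essInf_le (f := fun p : Plane × ℝ => pathLoss p.1 p.2) (μ := N)] with p hp
  exact h.trans hp

lemma measurable_servingPathLoss : Measurable servingPathLoss := by
  -- `L ≥ t` is the event that a fixed set is void.
  refine measurable_of_Ici fun t => ?_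
  have : servingPathLoss ⁻¹' Ici t = (fun N => N {p | pathLoss p.1 p.2 < t}) ⁻¹' {0} := by
    ext N
    exact le_servingPathLoss_iff N t
  rw [this]
  exact Measure.measurable_coe (measurableSet_lt measurable_pathLoss measurable_const)
    (measurableSet_singleton 0)

/-- Layer-cake formula on `[0, ∞]`. -/
lemma lintegral_eq_lintegral_measure_ofReal_le {Ω : Type*} [MeasurableSpace Ω] (P : Measure Ω)
    [SFinite P] {X : Ω → ℝ≥0∞} (hX : Measurable X) :
    ∫⁻ ω, X ω ∂P = ∫⁻ u in Ioi (0 : ℝ), P {ω | ENNReal.ofReal u ≤ X ω} := by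
  have hvol : ∀ x : ℝ≥0∞, ∫⁻ u in Ioi (0 : ℝ), (Ici (ENNReal.ofReal u)).indicator 1 x = x := by
    intro x
    have h1 : ∀ u : ℝ, (Ici (ENNReal.ofReal u)).indicator (1 : ℝ≥0∞ → ℝ≥0∞) x =
        {u : ℝ | ENNReal.ofReal u ≤ x}.indicator 1 u := fun u => by
      simp [indicator_apply]
    have hS : MeasurableSet {u : ℝ | ENNReal.ofReal u ≤ x} :=
      measurableSet_le (by fun_prop) measurable_const
    simp_rw [h1]
    rw [lintegral_indicator_one hS, Measure.restrict_apply hS]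
    by_cases hx : x = ∞
    · simp [hx]
    · have : {u : ℝ | ENNReal.ofReal u ≤ x} ∩ Ioi 0 = Ioc 0 x.toReal := by
        ext u
        simp only [mem_inter_iff, mem_ofPred_eq, mem_Ioi, mem_Ioc,
          ENNReal.ofReal_le_iff_le_toReal hx, and_comm]
      rw [this, Real.volume_Ioc, sub_zero, ENNReal.ofReal_toReal hx]
  have hm : MeasurableSet {q : Ω × ℝ | ENNReal.ofReal q.2 ≤ X q.1} :=
    measurableSet_le (by fun_prop) (by fun_prop)
  calc ∫⁻ ω, X ω ∂P
      = ∫⁻ ω, (∫⁻ u in Ioi (0 : ℝ), (Ici (ENNReal.ofReal u)).indicator 1 (X ω)) ∂P := by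
        simp_rw [hvol]
    _ = ∫⁻ u in Ioi (0 : ℝ), ∫⁻ ω, (Ici (ENNReal.ofReal u)).indicator 1 (X ω) ∂P := by
        refine lintegral_lintegral_swap (Measurable.aemeasurable ?_)
        exact (measurable_one (α := ℝ≥0∞)).indicator hm
    _ = _ := by
        refine lintegral_congr fun u => ?_
        rw [← lintegral_indicator_one (measurableSet_le measurable_const hX)]
        rfl

/-- The square root of the path loss `L` to the serving AP is exponential of rate `a`, so
`E[√L] = 1 / a`. -/
lemma lintegral_servingPathLoss_rpow {lam : ℝ} {σ : Measure ℝ} {Ω : Type*} [MeasurableSpace Ω]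
    {P : Measure Ω} [IsProbabilityMeasure P] {Φ : Ω → Measure (Plane × ℝ)}
    [IsProbabilityMeasure σ] (hlam : 0 < lam)
    (hσ : ∀ᵐ s ∂σ, 0 < s) (hσ' : ∫⁻ s, ENNReal.ofReal (s ^ (-(1 / 2) : ℝ)) ∂σ ≠ ∞)
    (h : IsPoissonProcess P Φ (apIntensity lam σ)) :
    ∫⁻ ω, servingPathLoss (Φ ω) ^ (1 / 2 : ℝ) ∂P = ENNReal.ofReal (sqrtLossRate lam σ)⁻¹ := by
  have ha := sqrtLossRate_pos hlam hσ hσ'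
  have hm : Measurable fun ω => servingPathLoss (Φ ω) ^ (1 / 2 : ℝ) :=
    (measurable_servingPathLoss.comp h.measurable).pow_const _
  rw [lintegral_eq_lintegral_measure_ofReal_le P hm, ← lintegral_exp_neg_mul ha]
  refine setLIntegral_congr_fun measurableSet_Ioi fun u hu => ?_
  have hu : 0 < u := hu
  have hiff : ∀ ω, ENNReal.ofReal u ≤ servingPathLoss (Φ ω) ^ (1 / 2 : ℝ) ↔
      Φ ω {p | pathLoss p.1 p.2 < ENNReal.ofReal (u ^ 2)} = 0 := fun ω => by
    rw [← le_servingPathLoss_iff, one_div, ENNReal.le_rpow_inv_iff two_pos,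
      ENNReal.ofReal_rpow_of_pos hu, Real.rpow_two]
  have hΛ := apIntensity_pathLoss_lt hlam hσ hσ' hu.le
  simp only [hiff]
  rw [h.measure_eq_zero (measurableSet_lt measurable_pathLoss measurable_const)
    (by rw [hΛ]; exact ENNReal.ofReal_ne_top), hΛ, expNeg_ofReal (by positivity)]

/-! ### The interference -/

/-- `∫_v^∞ γ v² / (r² + γ v²) dr = v √γ arctan √γ`. -/
lemma lintegral_Ioi_div_sq_add {γ v : ℝ} (hγ : 0 < γ) (hv : 0 ≤ v) :
    ∫⁻ r in Ioi v, ENNReal.ofReal (γ * v ^ 2 / (r ^ 2 + γ * v ^ 2)) =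
      ENNReal.ofReal (v * C γ) := by
  rcases hv.eq_or_lt with rfl | hv
  · simp
  have hs : 0 < √γ := Real.sqrt_pos.2 hγ
  set w := √γ * v with hw
  have hw0 : 0 < w := mul_pos hs hv
  have hw2 : γ * v ^ 2 = w ^ 2 := by rw [hw, mul_pow, Real.sq_sqrt hγ.le]
  have hd : ∀ r ∈ Ici v, HasDerivAt (fun r => w * Real.arctan (r / w))
      (w ^ 2 / (r ^ 2 + w ^ 2)) r :=
    fun r _ => by
      convert! (((hasDerivAt_id r).div_const w).arctan).const_mul w using 1
      have : 0 < r ^ 2 + w ^ 2 := by positivity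
      simp only [id]
      field_simp
      ring
  have hlim : Tendsto (fun r => w * Real.arctan (r / w)) atTop (𝓝 (w * (Real.pi / 2))) :=
    ((Real.tendsto_arctan_atTop.mono_right nhdsWithin_le_nhds).comp
      (tendsto_id.atTop_div_const hw0)).const_mul w
  have hpos : ∀ r ∈ Ioi v, 0 ≤ w ^ 2 / (r ^ 2 + w ^ 2) := fun r _ => by positivity
  rw [hw2, ← ofReal_integral_eq_lintegral_ofReal
    (integrableOn_Ioi_deriv_of_nonneg' hd hpos hlim)
    (ae_restrict_of_forall_mem measurableSet_Ioi hpos),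
    integral_Ioi_of_hasDerivAt_of_nonneg' hd hpos hlim]
  have : v / w = (√γ)⁻¹ := by rw [hw]; field_simp
  rw [this, Real.arctan_inv_of_pos hs, C]
  congr 1
  rw [hw]; ring

/-- The exponent of the Laplace transform of the interference from the devices whose own path loss
is `l`, integrated over their fading, position and shadowing. -/
lemma lintegral_crossLoss {lam : ℝ} {σ : Measure ℝ} [IsProbabilityMeasure σ] (hlam : 0 < lam)
    (hσ : ∀ᵐ s ∂σ, 0 < s) (hσ' : ∫⁻ s, ENNReal.ofReal (s ^ (-(1 / 2) : ℝ)) ∂σ ≠ ∞)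
    {γ : ℝ} (hγ : 0 < γ) {l : ℝ≥0∞} (hl : l ≠ ∞) :
    ∫⁻ p, (Ioi l).indicator (fun y => ∫⁻ h, (1 - expNeg (ENNReal.ofReal γ *
        (l * ENNReal.ofReal h / y))) ∂expMeasure 1) (pathLoss p.1 p.2) ∂apIntensity lam σ =
      ENNReal.ofReal (sqrtLossRate lam σ * C γ) * l ^ (1 / 2 : ℝ) := by
  have := isProbabilityMeasure_expMeasure one_pos
  have hF : Measurable fun q : ℝ≥0∞ × ℝ =>
      1 - expNeg (ENNReal.ofReal γ * (l * ENNReal.ofReal q.2 / q.1)) :=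
    measurable_const.sub (measurable_expNeg.comp (by fun_prop))
  rw [lintegral_pathLoss_apIntensity hlam hσ hσ'
    ((hF.lintegral_prod_right').indicator measurableSet_Ioi)]
  obtain ⟨v, hv, rfl⟩ : ∃ v : ℝ, 0 ≤ v ∧ l = ENNReal.ofReal (v ^ 2) :=
    ⟨√l.toReal, Real.sqrt_nonneg _, by
      rw [Real.sq_sqrt ENNReal.toReal_nonneg, ENNReal.ofReal_toReal hl]⟩
  have hroot : ENNReal.ofReal (v ^ 2) ^ (1 / 2 : ℝ) = ENNReal.ofReal v := by
    rw [ENNReal.ofReal_rpow_of_nonneg (by positivity) (by norm_num), ← Real.sqrt_eq_rpow,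
      Real.sqrt_sq hv]
  have hr : ∀ r ∈ Ioi (0 : ℝ), (Ioi (ENNReal.ofReal (v ^ 2))).indicator
      (fun y => ∫⁻ h, (1 - expNeg (ENNReal.ofReal γ *
        (ENNReal.ofReal (v ^ 2) * ENNReal.ofReal h / y))) ∂expMeasure 1) (ENNReal.ofReal (r ^ 2)) =
      (Ioi v).indicator (fun r => ENNReal.ofReal (γ * v ^ 2 / (r ^ 2 + γ * v ^ 2))) r := by
    intro r hr
    have hr : 0 < r := hr
    have hiff : ENNReal.ofReal (v ^ 2) < ENNReal.ofReal (r ^ 2) ↔ v < r := by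
      rw [ENNReal.ofReal_lt_ofReal_iff_of_nonneg (by positivity),
        pow_lt_pow_iff_left₀ hv hr.le two_ne_zero]
    simp only [indicator_apply, mem_Ioi, hiff]
    congr 1
    have hc : ∀ h, ENNReal.ofReal γ * (ENNReal.ofReal (v ^ 2) * ENNReal.ofReal h /
        ENNReal.ofReal (r ^ 2)) = ENNReal.ofReal (γ * v ^ 2 / r ^ 2) * ENNReal.ofReal h :=
      fun h => by
        rw [ENNReal.ofReal_div_of_pos (by positivity), ENNReal.ofReal_mul hγ.le]
        simp only [div_eq_mul_inv]
        ring
    simp_rw [hc]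
    rw [lintegral_one_sub_expNeg_expMeasure (by positivity)]
    congr 1
    field_simp
  have hIoi : Ioi (0 : ℝ) ∩ Ioi v = Ioi v := inter_eq_right.2 (Ioi_subset_Ioi hv)
  rw [setLIntegral_congr_fun measurableSet_Ioi hr, lintegral_indicator measurableSet_Ioi,
    Measure.restrict_restrict measurableSet_Ioi, inter_comm, hIoi,
    lintegral_Ioi_div_sq_add hγ hv, hroot,
    ENNReal.ofReal_mul (sqrtLossRate_pos hlam hσ hσ').le, ENNReal.ofReal_mul hv]
  ring

@[fun_prop]
lemma measurable_ownLoss : Measurable Interferer.ownLoss := by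
  unfold Interferer.ownLoss
  fun_prop

@[fun_prop]
lemma measurable_crossLoss : Measurable Interferer.crossLoss := by
  unfold Interferer.crossLoss pathLoss
  fun_prop

@[fun_prop]
lemma measurable_interferer_fading : Measurable Interferer.fading := by
  unfold Interferer.fading
  fun_prop

lemma measurable_interference : Measurable interference :=
  Measure.measurable_lintegral (by fun_prop)

instance (lam : ℝ) (σ : Measure ℝ) [SigmaFinite σ] : SigmaFinite (apIntensity lam σ) :=
  inferInstanceAs (SigmaFinite
    ((((ENNReal.ofReal lam).toNNReal • volume : Measure Plane)).prod σ))

/-- The exponent of the Laplace transform of the interference. The rate `a` of the intensity cancels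
against `E[√L] = 1 / a`, so that it depends on `γ` alone. The hypothesis `hκ` also excludes an
infinite own path loss. -/
lemma lintegral_interfererIntensity {lam : ℝ} {σ : Measure ℝ} [IsProbabilityMeasure σ]
    (hlam : 0 < lam)
    (hσ : ∀ᵐ s ∂σ, 0 < s) (hσ' : ∫⁻ s, ENNReal.ofReal (s ^ (-(1 / 2) : ℝ)) ∂σ ≠ ∞)
    (κ : Measure ℝ≥0∞) [IsProbabilityMeasure κ]
    (hκ : ∫⁻ l, l ^ (1 / 2 : ℝ) ∂κ = ENNReal.ofReal (sqrtLossRate lam σ)⁻¹)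
    {γ : ℝ} (hγ : 0 < γ) :
    ∫⁻ z, (1 - expNeg (ENNReal.ofReal γ * (z.ownLoss * ENNReal.ofReal z.fading / z.crossLoss)))
      ∂interfererIntensity lam σ κ = ENNReal.ofReal (C γ) := by
  have := isProbabilityMeasure_expMeasure one_pos
  have ha := sqrtLossRate_pos hlam hσ hσ'
  have hS : MeasurableSet {z : Interferer | z.ownLoss < z.crossLoss} :=
    measurableSet_lt (by fun_prop) (by fun_prop)
  have hf : Measurable fun z : Interferer => 1 - expNeg (ENNReal.ofReal γ *
      (z.ownLoss * ENNReal.ofReal z.fading / z.crossLoss)) :=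
    measurable_const.sub (measurable_expNeg.comp (by fun_prop))
  -- `√l` has a finite mean.
  have hfin : ∀ᵐ l ∂κ, l ≠ ∞ := by
    filter_upwards [ae_lt_top (f := fun l : ℝ≥0∞ => l ^ (1 / 2 : ℝ)) (by fun_prop)
      (by rw [hκ]; exact ENNReal.ofReal_ne_top)] with l hl
    rintro rfl
    simp at hl
  rw [interfererIntensity, ← lintegral_indicator hS,
    lintegral_prod _ (hf.indicator hS).aemeasurable]
  have hg : Measurable fun q : (Plane × ℝ) × ℝ≥0∞ => ∫⁻ h, {z : Interferer |
      z.ownLoss < z.crossLoss}.indicator (fun z => 1 - expNeg (ENNReal.ofReal γ *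
      (z.ownLoss * ENNReal.ofReal z.fading / z.crossLoss))) (q.1, q.2, h) ∂expMeasure 1 :=
    ((hf.indicator hS).comp MeasurableEquiv.prodAssoc.measurable).lintegral_prod_right'
  have hstep : ∀ p : Plane × ℝ, ∫⁻ m, {z : Interferer |
      z.ownLoss < z.crossLoss}.indicator (fun z => 1 - expNeg (ENNReal.ofReal γ *
      (z.ownLoss * ENNReal.ofReal z.fading / z.crossLoss))) (p, m) ∂κ.prod (expMeasure 1) =
      ∫⁻ l, ∫⁻ h, {z : Interferer |
      z.ownLoss < z.crossLoss}.indicator (fun z => 1 - expNeg (ENNReal.ofReal γ *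
      (z.ownLoss * ENNReal.ofReal z.fading / z.crossLoss))) (p, l, h) ∂expMeasure 1 ∂κ := fun p =>
    lintegral_prod _ ((hf.indicator hS).comp measurable_prodMk_left).aemeasurable
  simp_rw [hstep]
  -- The position is integrated out before the own path loss `l`.
  rw [lintegral_lintegral_swap hg.aemeasurable]
  have hinner : ∀ᵐ l ∂κ, ∫⁻ p, ∫⁻ h, {z : Interferer |
      z.ownLoss < z.crossLoss}.indicator (fun z => 1 - expNeg (ENNReal.ofReal γ *
      (z.ownLoss * ENNReal.ofReal z.fading / z.crossLoss))) (p, l, h) ∂expMeasure 1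
        ∂apIntensity lam σ =
      ENNReal.ofReal (sqrtLossRate lam σ * C γ) * l ^ (1 / 2 : ℝ) := by
    filter_upwards [hfin] with l hl
    rw [← lintegral_crossLoss hlam hσ hσ' hγ hl]
    refine lintegral_congr fun p => ?_
    simp only [indicator_apply, mem_ofPred_eq, Interferer.ownLoss, Interferer.crossLoss,
      Interferer.fading, mem_Ioi]
    split_ifs <;> simp
  rw [lintegral_congr_ae hinner, lintegral_const_mul _ (by fun_prop), hκ,
    ← ENNReal.ofReal_mul (mul_nonneg ha.le (by unfold C; positivity))]
  congr 1
  field_simp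

/-! ### Coverage probability -/

/-- The coverage probability. As the fading of the typical link is exponential, it is the Laplace
transform of the interference. -/
theorem IsNetwork.measure_mul_interference_le {Ω : Type*} [MeasurableSpace Ω] {P : Measure Ω}
    [IsProbabilityMeasure P] {σ : Measure ℝ} [IsProbabilityMeasure σ] {lam : ℝ}
    {Φ : Ω → Measure (Plane × ℝ)} {Ψ : Ω → Measure Interferer} {H : Ω → ℝ}
    (hnet : IsNetwork P σ lam Φ Ψ H) (hlam : 0 < lam) (hσ : ∀ᵐ s ∂σ, 0 < s)
    (hσ' : ∫⁻ s, ENNReal.ofReal (s ^ (-(1 / 2) : ℝ)) ∂σ ≠ ∞) {γ : ℝ} (hγ : 0 < γ) :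
    P {ω | ENNReal.ofReal γ * interference (Ψ ω) ≤ ENNReal.ofReal (H ω)} =
      ENNReal.ofReal (Real.exp (-C γ)) := by
  have := isProbabilityMeasure_expMeasure one_pos
  have hL : Measurable fun ω => servingPathLoss (Φ ω) :=
    measurable_servingPathLoss.comp hnet.aps.measurable
  have hI : Measurable fun ω => interference (Ψ ω) :=
    measurable_interference.comp hnet.interferers.measurable
  set κ := P.map fun ω => servingPathLoss (Φ ω) with hκdef
  have : IsProbabilityMeasure κ := Measure.isProbabilityMeasure_map hL.aemeasurable
  have : SigmaFinite (interfererIntensity lam σ κ) := by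
    unfold interfererIntensity; infer_instance
  have hκ : ∫⁻ l, l ^ (1 / 2 : ℝ) ∂κ = ENNReal.ofReal (sqrtLossRate lam σ)⁻¹ := by
    rw [hκdef, lintegral_map (by fun_prop) hL,
      lintegral_servingPathLoss_rpow hlam hσ hσ' hnet.aps]
  have hind : IndepFun H (fun ω => interference (Ψ ω)) P :=
    hnet.indep.comp measurable_id measurable_interference
  have hS : MeasurableSet {p : ℝ × ℝ≥0∞ | ENNReal.ofReal γ * p.2 ≤ ENNReal.ofReal p.1} :=
    measurableSet_le (by fun_prop) (by fun_prop)
  have hlaw : P {ω | ENNReal.ofReal γ * interference (Ψ ω) ≤ ENNReal.ofReal (H ω)} =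
      ∫⁻ ω, expNeg (ENNReal.ofReal γ * interference (Ψ ω)) ∂P := by
    have h1 : P {ω | ENNReal.ofReal γ * interference (Ψ ω) ≤ ENNReal.ofReal (H ω)} =
        (P.map fun ω => (H ω, interference (Ψ ω)))
          {p : ℝ × ℝ≥0∞ | ENNReal.ofReal γ * p.2 ≤ ENNReal.ofReal p.1} :=
      (Measure.map_apply (hnet.measurable_fading.prodMk hI) hS).symm
    rw [h1, (indepFun_iff_map_prod_eq_prod_map_map hnet.measurable_fading.aemeasurable
      hI.aemeasurable).1 hind, hnet.fading.map_eq]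
    have := Measure.isProbabilityMeasure_map (μ := P) hI.aemeasurable
    rw [Measure.prod_apply_symm hS, lintegral_map (measurable_measure_prodMk_right hS) hI]
    exact lintegral_congr fun ω => expMeasure_le_ofReal (ENNReal.ofReal γ * interference (Ψ ω))
  have hmeas : Measurable fun z : Interferer => z.ownLoss * ENNReal.ofReal z.fading / z.crossLoss :=
    by fun_prop
  have hC : 0 ≤ C γ := by unfold C; positivity
  rw [hlaw, ← expNeg_ofReal hC, ← lintegral_interfererIntensity hlam hσ hσ' κ hκ hγ,
    ← hnet.interferers.lintegral_expNeg (hmeas.const_mul _)]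
  refine lintegral_congr fun ω => ?_
  rw [lintegral_const_mul _ hmeas, interference]

/-! ### The delay constraint -/

/-- A spectral efficiency is above a threshold exactly when the SINR is. -/
lemma ofReal_le_spectralEfficiency_iff (c : ℝ) (x : ℝ≥0∞) :
    ENNReal.ofReal c ≤ spectralEfficiency x ↔ ENNReal.ofReal (2 ^ c - 1) ≤ x := by
  unfold spectralEfficiency
  split_ifs with hx
  · simp [hx]
  have hx0 : 0 ≤ x.toReal := ENNReal.toReal_nonneg
  rw [ENNReal.ofReal_le_ofReal_iff (Real.logb_nonneg one_lt_two (by linarith)),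
    ENNReal.ofReal_le_iff_le_toReal hx, Real.le_logb_iff_rpow_le one_lt_two (by linarith)]
  constructor <;> intro h <;> linarith

lemma cloudDelay_self_le_iff {q δc δt : ℝ} (hq : 0 < q) (hδc : 0 ≤ δc) (hδt : δc < δt)
    (R : ℝ≥0∞) :
    cloudDelay q δc R R ≤ ENNReal.ofReal δt ↔ ENNReal.ofReal (q / (δt - δc)) ≤ R := by
  have hd : 0 < δt - δc := sub_pos.2 hδt
  have hsum : ENNReal.ofReal q / (2 * R) + ENNReal.ofReal q / (2 * R) = ENNReal.ofReal q / R := by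
    rw [← two_mul, mul_div_assoc', ENNReal.mul_div_mul_left _ _ two_ne_zero ENNReal.ofNat_ne_top]
  have hδ : ENNReal.ofReal δt = ENNReal.ofReal (δt - δc) + ENNReal.ofReal δc := by
    rw [← ENNReal.ofReal_add hd.le hδc]; simp
  rw [cloudDelay, hsum, hδ, ENNReal.add_le_add_iff_right ENNReal.ofReal_ne_top,
    ENNReal.ofReal_div_of_pos hd]
  have hq' : ENNReal.ofReal q ≠ 0 := by simpa using hq
  have hd' : ENNReal.ofReal (δt - δc) ≠ 0 := by simpa using hδt
  rw [ENNReal.div_le_iff_le_mul (Or.inr ENNReal.ofReal_ne_top) (Or.inr hd'),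
    ENNReal.div_le_iff_le_mul (Or.inl hd') (Or.inl ENNReal.ofReal_ne_top), mul_comm]

/-- The SINR at which the cloud inference delay meets its budget, for AP density `lam`. -/
noncomputable def sinrThreshold (rmin lamu lam : ℝ) : ℝ := 2 ^ (rmin * meanLoad lam lamu) - 1

lemma meanLoad_pos {lam lamu : ℝ} (hlam : 0 < lam) (hu : 0 < lamu) : 0 < meanLoad lam lamu := by
  unfold meanLoad; positivity

lemma sinrThreshold_pos {rmin lam lamu : ℝ} (hr : 0 < rmin) (hlam : 0 < lam) (hu : 0 < lamu) :
    0 < sinrThreshold rmin lamu lam :=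
  sub_pos.2 (Real.one_lt_rpow one_lt_two (mul_pos hr (meanLoad_pos hlam hu)))

lemma inferenceRate_pos {q b δt δc : ℝ} (hq : 0 < q) (hb : 0 < b) (hδt : δc < δt) :
    0 < inferenceRate q b δt δc := div_pos hq (mul_pos hb (sub_pos.2 hδt))

/-- For a fading `h > 0`, the delay meets its budget exactly when the SINR meets its threshold. For
`h = 0` this fails if there is no interference, as the SINR is then `0 / 0 = 0`. -/
lemma typicalDelay_le_iff {q b δc δt lamu lam h : ℝ} (hq : 0 < q) (hb : 0 < b) (hδc : 0 ≤ δc)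
    (hδt : δc < δt) (hu : 0 < lamu) (hlam : 0 < lam) (hh : 0 < h) (N : Measure Interferer) :
    typicalDelay q b δc lamu ∞ lam h N ≤ ENNReal.ofReal δt ↔
      ENNReal.ofReal (sinrThreshold (inferenceRate q b δt δc) lamu lam) * interference N ≤
        ENNReal.ofReal h := by
  have hload := meanLoad_pos hlam hu
  have hr := inferenceRate_pos hq hb hδt
  have hbl : 0 < b / meanLoad lam lamu := div_pos hb hload
  have hd : 0 < δt - δc := sub_pos.2 hδt
  have hc : q / (δt - δc) =
      inferenceRate q b δt δc * meanLoad lam lamu * (b / meanLoad lam lamu) := by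
    unfold inferenceRate; field_simp
  have hbl' : ENNReal.ofReal (b / meanLoad lam lamu) ≠ 0 := by simpa using hbl
  have hh' : ENNReal.ofReal h ≠ 0 := by simpa using hh
  rw [typicalDelay, cloudDelay_self_le_iff hq hδc hδt, rate, hc,
    ENNReal.ofReal_mul (mul_pos hr hload).le, mul_comm (ENNReal.ofReal (b / _)),
    ENNReal.mul_le_mul_iff_left hbl' ENNReal.ofReal_ne_top,
    ofReal_le_spectralEfficiency_iff, uplinkSINR, ENNReal.inv_top, zero_add,
    ENNReal.le_div_iff_mul_le (Or.inr hh') (Or.inr ENNReal.ofReal_ne_top), sinrThreshold]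

/-! ### The average mean squared error -/

lemma averageMSE_eq_of_ae_iff {Ω : Type*} [MeasurableSpace Ω] {P : Measure Ω}
    [IsProbabilityMeasure P] {D : Ω → ℝ≥0∞} {δt : ℝ} {S : Set Ω} (hS : MeasurableSet S)
    (hD : ∀ᵐ ω ∂P, D ω ≤ ENNReal.ofReal δt ↔ ω ∈ S) (mc md : ℝ) :
    averageMSE P D δt mc md = md - (md - mc) * P.real S := by
  have hset : {ω | D ω ≤ ENNReal.ofReal δt} =ᵐ[P] S :=
    eventuallyEq_set.2 hD
  have hset' : {ω | ENNReal.ofReal δt < D ω} =ᵐ[P] (Sᶜ : Set Ω) := by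
    have : {ω | ENNReal.ofReal δt < D ω} = {ω | D ω ≤ ENNReal.ofReal δt}ᶜ := by ext; simp
    exact this ▸ hset.compl
  have h1 : ∫ ω, {ω | D ω ≤ ENNReal.ofReal δt}.indicator (fun _ => mc) ω ∂P = P.real S * mc := by
    rw [integral_congr_ae (indicator_ae_eq_of_ae_eq_set hset), integral_indicator_const _ hS,
      smul_eq_mul]
  have h2 : ∫ ω, {ω | ENNReal.ofReal δt < D ω}.indicator (fun _ => md) ω ∂P =
      (1 - P.real S) * md := by
    rw [integral_congr_ae (indicator_ae_eq_of_ae_eq_set hset'),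
      integral_indicator_const _ hS.compl, smul_eq_mul, probReal_compl_eq_one_sub hS]
  rw [averageMSE, h1, h2]
  ring

/-- The average MSE at AP density `lam`, in closed form. -/
theorem IsNetwork.averageMSE_eq {Ω : Type*} [MeasurableSpace Ω] {P : Measure Ω}
    [IsProbabilityMeasure P] {σ : Measure ℝ} [IsProbabilityMeasure σ] {lam : ℝ}
    {Φ : Ω → Measure (Plane × ℝ)} {Ψ : Ω → Measure Interferer} {H : Ω → ℝ}
    (hnet : IsNetwork P σ lam Φ Ψ H) (hlam : 0 < lam) (hσ : ∀ᵐ s ∂σ, 0 < s)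
    (hσ' : ∫⁻ s, ENNReal.ofReal (s ^ (-(1 / 2) : ℝ)) ∂σ ≠ ∞) {q b δt δc lamu : ℝ}
    (hq : 0 < q) (hb : 0 < b) (hδc : 0 ≤ δc) (hδt : δc < δt) (hu : 0 < lamu) (mc md : ℝ) :
    averageMSE P (fun ω => typicalDelay q b δc lamu ∞ lam (H ω) (Ψ ω)) δt mc md =
      md - (md - mc) *
        Real.exp (-C (sinrThreshold (inferenceRate q b δt δc) lamu lam)) := by
  have hγ := sinrThreshold_pos (inferenceRate_pos hq hb hδt) hlam hu
  have hI : Measurable fun ω => interference (Ψ ω) :=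
    measurable_interference.comp hnet.interferers.measurable
  have hH : ∀ᵐ ω ∂P, 0 < H ω := by
    rw [hnet.fading.ae_iff (p := fun h => 0 < h) (by fun_prop), ae_iff]
    have h0 : Measurable fun h : ℝ => (Iic (0 : ℝ)).indicator (1 : ℝ → ℝ≥0∞) h :=
      measurable_one.indicator measurableSet_Iic
    have : {h : ℝ | ¬ 0 < h} = Iic 0 := by ext; simp
    rw [this, ← lintegral_indicator_one measurableSet_Iic, lintegral_expMeasure _ h0,
      setLIntegral_congr_fun measurableSet_Ioi (g := fun _ => 0), lintegral_zero]
    intro h hh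
    simp [mem_Ioi.1 hh]
  rw [averageMSE_eq_of_ae_iff
    (S := {ω | ENNReal.ofReal (sinrThreshold (inferenceRate q b δt δc) lamu lam) *
      interference (Ψ ω) ≤ ENNReal.ofReal (H ω)})
    (measurableSet_le (hI.const_mul _) hnet.measurable_fading.ennreal_ofReal) ?_, measureReal_def,
    hnet.measure_mul_interference_le hlam hσ hσ' hγ, ENNReal.toReal_ofReal (Real.exp_pos _).le]
  filter_upwards [hH] with ω hω
  exact typicalDelay_le_iff hq hb hδc hδt hu hlam hω _

/-! ### The function `C` -/

lemma C_zero : C 0 = 0 := by simp [C]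

lemma continuous_C : Continuous C := by
  unfold C; exact Real.continuous_sqrt.mul (Real.continuous_arctan.comp Real.continuous_sqrt)

lemma strictMonoOn_C : StrictMonoOn C (Ici 0) := fun x hx y _ hxy => by
  have h := Real.sqrt_lt_sqrt hx hxy
  exact mul_lt_mul'' h (Real.arctan_strictMono h) (Real.sqrt_nonneg _)
    (Real.arctan_nonneg.2 (Real.sqrt_nonneg _))

lemma tendsto_C_atTop : Tendsto C atTop atTop :=
  Real.tendsto_sqrt_atTop.atTop_mul_pos (C := Real.pi / 2) (by positivity)
    ((Real.tendsto_arctan_atTop.mono_right nhdsWithin_le_nhds).comp Real.tendsto_sqrt_atTop)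

lemma surjOn_C : SurjOn C (Ici 0) (Ici 0) := fun y hy => by
  obtain ⟨b, hb, hb0⟩ := ((tendsto_C_atTop.eventually_ge_atTop y).and
    (eventually_ge_atTop 0)).exists
  obtain ⟨x, hx, rfl⟩ := intermediate_value_Icc hb0 continuous_C.continuousOn
    ⟨C_zero.trans_le hy, hb⟩
  exact ⟨x, hx.1, rfl⟩

lemma Cinv_nonneg {y : ℝ} (hy : 0 ≤ y) : 0 ≤ Cinv y := Function.invFunOn_mem (surjOn_C hy)

lemma C_Cinv {y : ℝ} (hy : 0 ≤ y) : C (Cinv y) = y := Function.invFunOn_eq (surjOn_C hy)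

lemma C_le_iff_le_Cinv {x y : ℝ} (hx : 0 ≤ x) (hy : 0 ≤ y) : C x ≤ y ↔ x ≤ Cinv y := by
  rw [← strictMonoOn_C.le_iff_le hx (Cinv_nonneg hy), C_Cinv hy]

lemma C_lt_iff_lt_Cinv {x y : ℝ} (hx : 0 ≤ x) (hy : 0 ≤ y) : C x < y ↔ x < Cinv y := by
  rw [← strictMonoOn_C.lt_iff_lt hx (Cinv_nonneg hy), C_Cinv hy]

/-! ### The critical density -/

/-- As the AP density grows the load tends to `1`, and the SINR threshold to `2^rmin - 1`. -/
lemma tendsto_sinrThreshold (rmin lamu : ℝ) :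
    Tendsto (sinrThreshold rmin lamu) atTop (𝓝 (2 ^ rmin - 1)) := by
  have h1 : Tendsto (fun lam => meanLoad lam lamu) atTop (𝓝 1) := by
    have : (fun lam : ℝ => meanLoad lam lamu) = fun lam => 1 + 1.28 * lamu / lam := by
      ext lam; simp only [meanLoad]; rw [div_div_eq_mul_div]
    rw [this]
    simpa using (tendsto_const_nhds (x := (1 : ℝ))).add
      (tendsto_const_nhds.div_atTop tendsto_id (a := (1.28 * lamu : ℝ)))
  have h2 := (tendsto_const_nhds (x := (2 : ℝ)).rpow (h1.const_mul rmin)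
    (Or.inl two_ne_zero)).sub_const 1
  rwa [mul_one] at h2

/-- With a coverage probability `exp (-x)`, the target MSE is met exactly when `x` is at most
`log ((md - mc) / (md - mt))`. -/
lemma sub_mul_exp_neg_le_iff {mc md mt x : ℝ} (hcd : mc < md) (hmt : mt < md) :
    md - (md - mc) * Real.exp (-x) ≤ mt ↔ x ≤ Real.log ((md - mc) / (md - mt)) := by
  have h1 : 0 < md - mc := sub_pos.2 hcd
  have h2 : 0 < md - mt := sub_pos.2 hmt
  rw [Real.le_log_iff_exp_le (div_pos h1 h2), le_div_iff₀ h2, Real.exp_neg, ← div_eq_mul_inv,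
    sub_le_comm, le_div_iff₀ (Real.exp_pos x), mul_comm]

lemma sub_mul_exp_neg_lt_iff {mc md mt x : ℝ} (hcd : mc < md) (hmt : mt < md) :
    md - (md - mc) * Real.exp (-x) < mt ↔ x < Real.log ((md - mc) / (md - mt)) := by
  have h1 : 0 < md - mc := sub_pos.2 hcd
  have h2 : 0 < md - mt := sub_pos.2 hmt
  rw [Real.lt_log_iff_exp_lt (div_pos h1 h2), lt_div_iff₀ h2, Real.exp_neg, ← div_eq_mul_inv,
    sub_lt_comm, lt_div_iff₀ (Real.exp_pos x), mul_comm]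

lemma one_div_mul_logb_sub_one_pos {rmin x : ℝ} (hr : 0 < rmin) (hx : 2 ^ rmin - 1 < x) :
    0 < 1 / rmin * Real.logb 2 (1 + x) - 1 := by
  have h2 : (0 : ℝ) < 2 ^ rmin := by positivity
  rw [one_div, inv_mul_eq_div, sub_pos, one_lt_div hr,
    Real.lt_logb_iff_rpow_lt one_lt_two (by linarith)]
  linarith

lemma criticalDensity_pos {rmin lamu mc md mt : ℝ} (hr : 0 < rmin) (hu : 0 < lamu)
    (hx : 2 ^ rmin - 1 < Cinv (Real.log ((md - mc) / (md - mt)))) :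
    0 < criticalDensity lamu rmin mc md mt :=
  mul_pos (by positivity) (inv_pos.2 (one_div_mul_logb_sub_one_pos hr hx))

lemma sinrThreshold_le_iff {rmin lamu lam x : ℝ} (hr : 0 < rmin) (hlam : 0 < lam)
    (hx : 2 ^ rmin - 1 < x) :
    sinrThreshold rmin lamu lam ≤ x ↔
      1.28 * lamu * (1 / rmin * Real.logb 2 (1 + x) - 1)⁻¹ ≤ lam := by
  have h2 : (0 : ℝ) < 2 ^ rmin := by positivity
  have hx1 : 0 < 1 + x := by linarith
  have hA := one_div_mul_logb_sub_one_pos hr hx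
  rw [sinrThreshold, sub_le_iff_le_add', ← Real.le_logb_iff_rpow_le one_lt_two hx1,
    ← div_eq_mul_inv, div_le_iff₀ hA, ← le_div_iff₀' hr, meanLoad, div_div_eq_mul_div,
    ← le_sub_iff_add_le', div_le_iff₀' hlam, one_div, inv_mul_eq_div]

end EdgeCloud

theorem corollary2
    -- true output `y`, edge output `yd`, cloud output `yc`
    {A : Type*} [MeasurableSpace A] (ν : Measure A) [IsProbabilityMeasure ν] (y yd yc : A → ℝ)
    (hyd : MemLp (fun a => y a - yd a) 2 ν) (hyc : MemLp (fun a => y a - yc a) 2 ν)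
    (mc md mt : ℝ) (hmd : md = EdgeCloud.mse ν y yd) (hmc : mc = EdgeCloud.mse ν y yc)
    (hcd : mc ≤ md)
    -- payload, bandwidth, delay budget, compute delay, density of devices
    (q b δt δc lamu : ℝ) (hq : 0 < q) (hb : 0 < b) (hδc : 0 ≤ δc) (hδt : δc < δt) (hu : 0 < lamu)
    -- law of the shadowing
    (σ : Measure ℝ) [IsProbabilityMeasure σ] (hσ : ∀ᵐ s ∂σ, 0 < s)
    (hσ' : ∫⁻ s, ENNReal.ofReal (s ^ (-(1 / 2) : ℝ)) ∂σ ≠ ∞)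
    -- for each density of access points, a network
    {Ω : Type*} [MeasurableSpace Ω] (P : Measure Ω) [IsProbabilityMeasure P]
    (Φ : ℝ → Ω → Measure (EdgeCloud.Plane × ℝ)) (Ψ : ℝ → Ω → Measure EdgeCloud.Interferer)
    (H : ℝ → Ω → ℝ) (hnet : ∀ lam, 0 < lam → EdgeCloud.IsNetwork P σ lam (Φ lam) (Ψ lam) (H lam))
    -- the average MSE as a function of the density (interference-limited: infinite SNR)
    (m : ℝ → ℝ)
    (hm : ∀ lam, m lam = EdgeCloud.averageMSE P
      (fun ω => EdgeCloud.typicalDelay q b δc lamu ∞ lam (H lam ω) (Ψ lam ω)) δt mc md)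
    -- the target MSE
    (hmt : EdgeCloud.asymptoticMSE m < mt) (hmt' : mt < md) :
    IsLeast {lam : ℝ | 0 < lam ∧ m lam ≤ mt}
        (EdgeCloud.criticalDensity lamu (EdgeCloud.inferenceRate q b δt δc) mc md mt) ∧
      ∀ lam,
        EdgeCloud.criticalDensity lamu (EdgeCloud.inferenceRate q b δt δc) mc md mt ≤ lam →
          m lam ≤ mt := by
  have hr := EdgeCloud.inferenceRate_pos hq hb hδt
  set r := EdgeCloud.inferenceRate q b δt δc with hrdef
  have hm' : ∀ lam, 0 < lam →
      m lam = md - (md - mc) * Real.exp (-EdgeCloud.C (EdgeCloud.sinrThreshold r lamu lam)) :=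
    fun lam hlam => by
      rw [hm, (hnet lam hlam).averageMSE_eq hlam hσ hσ' hq hb hδc hδt hu]
  have hlim : Filter.Tendsto m Filter.atTop
      (nhds (md - (md - mc) * Real.exp (-EdgeCloud.C (2 ^ r - 1)))) := by
    refine Filter.Tendsto.congr' (f₁ := fun lam =>
      md - (md - mc) * Real.exp (-EdgeCloud.C (EdgeCloud.sinrThreshold r lamu lam))) ?_ ?_
    · filter_upwards [Filter.eventually_gt_atTop 0] with lam hlam using (hm' lam hlam).symm
    · exact ((((EdgeCloud.continuous_C.tendsto _).comp
        (EdgeCloud.tendsto_sinrThreshold r lamu)).neg.rexp).const_mul _).const_sub _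
  rw [EdgeCloud.asymptoticMSE, hlim.limUnder_eq] at hmt
  -- If `mc = md`, the asymptotic MSE is `md`, and no target lies below `md` and above it.
  have hlt : mc < md := by
    refine hcd.lt_of_ne fun h => ?_
    rw [h, sub_self, zero_mul, sub_zero] at hmt
    exact lt_asymm hmt hmt'
  have hγ0 : (0 : ℝ) ≤ 2 ^ r - 1 := sub_nonneg.2 (Real.one_le_rpow one_le_two hr.le)
  rw [EdgeCloud.sub_mul_exp_neg_lt_iff hlt hmt'] at hmt
  have hlog : 0 ≤ Real.log ((md - mc) / (md - mt)) :=
    (EdgeCloud.C_zero.symm.le.trans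
      (EdgeCloud.strictMonoOn_C.monotoneOn Set.self_mem_Ici hγ0 hγ0)).trans hmt.le
  rw [EdgeCloud.C_lt_iff_lt_Cinv hγ0 hlog] at hmt
  have hiff : ∀ lam, 0 < lam →
      (m lam ≤ mt ↔ EdgeCloud.criticalDensity lamu r mc md mt ≤ lam) := fun lam hlam => by
    rw [hm' lam hlam, EdgeCloud.sub_mul_exp_neg_le_iff hlt hmt',
      EdgeCloud.C_le_iff_le_Cinv (EdgeCloud.sinrThreshold_pos hr hlam hu).le hlog,
      EdgeCloud.sinrThreshold_le_iff hr hlam hmt]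
    rfl
  have hpos : 0 < EdgeCloud.criticalDensity lamu r mc md mt :=
    EdgeCloud.criticalDensity_pos hr hu hmt
  exact ⟨⟨⟨hpos, (hiff _ hpos).2 le_rfl⟩, fun lam hlam => (hiff lam hlam.1).1 hlam.2⟩,
    fun lam hlam => (hiff lam (hpos.trans_le hlam)).2 hlam⟩
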